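/- Let $Q\ge 3$, let $\mathcal X$ be a measurable space, $\mathcal Y=\{1,\dots,Q\}$, let $P$ be a probability measure on $\mathcal X\times\mathcal Y$ with marginal $P_{\mathcal X}$ on $\mathcal X$, let $m\ge 1$ and let $\mathcal G$ be a class of measurable functions $g=(g_k)_{1\le k\le Q}:\mathcal X\to\mathbb R^Q$. The risk of $g$ is $$R(g)=P\Big\{(x,y): g_y(x)\le\max_{k\ne y}g_k(x)\Big\}.$$ The operators $\Delta$ and $\Delta^*$ are given by $$\Delta g_k(x)=\tfrac12\Big(g_k(x)-\max_{l\ne k}g_l(x)\Big),\qquad \Delta^* g_k(x)=\operatorname{sign}(\Delta g_k(x))\cdot\max_{j}\Delta g_j(x).$$ Let $\Delta^{\#}$ be either of them. For $\gamma>0$ let $\Delta^{\#}_\gamma g=\big(\operatorname{sign}(\Delta^{\#}g_k)\min(|\Delta^{\#}g_k|,\gamma)\big)_{1\le k\le Q}$ and $\Delta^{\#}_\gamma\mathcal G=\{\Delta^{\#}_\gamma g: g\in\mathcal G\}$. On a sample $s_m=((X_i,Y_i))_{1\le i\le m}$ the empirical risk with margin $\gamma$ is $$R_{\gamma,s_m}(g)=\frac1m\,\#\{i:\Delta^{\#}g_{Y_i}(X_i)<\gamma\}.$$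 For a set $\mathcal F$ of functions $\mathcal X\to\mathbb R^Q$, $\epsilon>0$ and $n\ge 1$, let $\mathcal N^{(p)}_{\infty,\infty}(\epsilon,\mathcal F,n)\in\mathbb N\cup\{\infty\}$ be the supremum, over all $(x_1,\dots,x_n)\in\mathcal X^n$, of the smallest cardinality of a set $\mathcal F'\subseteq\mathcal F$ such that every $f\in\mathcal F$ satisfies $\max_{i}\|f(x_i)-f'(x_i)\|_\infty<\epsilon$ for some $f'\in\mathcal F'$ (this smallest cardinality being $\infty$ if no such set is finite). Assume the usual measurability of the class: for every open $U\subseteq(\mathbb R^Q)^{2m}$, the set $\{x\in\mathcal X^{2m}:(g(x_1),\dots,g(x_{2m}))\in U\text{ for some }g\in\mathcal G\}$ is measurable up to a $P_{\mathcal X}^{\otimes 2m}$-null set (this holds, for instance, if $\mathcal G$ is countable, or if it has a countable subclass such that every function in $\mathcal G$ is the pointwise limit of a sequence from it). Let $s_m$ be a sample of $m$ independent pairs with distribution $P$, and let $\delta\in(0,1)$. Then, with probability at least $1-\delta$, for every $\gamma\in(0,1]$ and every $g\in\mathcal G$, $$R(g)\le R_{\gamma,s_m}(g)+\sqrt{\frac2m\left(\ln\big(2\,\mathcal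 N^{(p)}_{\infty,\infty}(\gamma/4,\Delta^{\#}_\gamma\mathcal G,2m)\big)+\ln\frac{2}{\gamma\delta}\right)}+\frac1m,$$ where the right-hand side is $+\infty$ if the covering number is infinite. -/

import Mathlib

open MeasureTheory ProbabilityTheory

noncomputable section

namespace LargeMargin

/-- The largest score among the categories other than `k`
(a maximum over a nonempty finite set as soon as `2 ≤ Q`). -/
def maxOther {Q : ℕ} (v : Fin Q → ℝ) (k : Fin Q) : ℝ :=
  ⨆ l : {l : Fin Q // l ≠ k}, v l

/-- The `0`-`1` loss of the score vector `v` on the category `y`; ties count as errors. -/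
def loss {Q : ℕ} (y : Fin Q) (v : Fin Q → ℝ) : ℝ :=
  if v y ≤ maxOther v y then 1 else 0

/-- The operator `Δ`, on score vectors. -/
def marginDelta {Q : ℕ} (v : Fin Q → ℝ) : Fin Q → ℝ :=
  fun k => (1 / 2) * (v k - maxOther v k)

/-- The operator `Δ*`, on score vectors: `sign (Δ v k) * max_j (Δ v j)`. -/
def marginDeltaStar {Q : ℕ} (v : Fin Q → ℝ) : Fin Q → ℝ :=
  fun k => Real.sign (marginDelta v k) * ⨆ j : Fin Q, marginDelta v j

/-- The two margin operators. -/
inductive MarginOp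
  | delta
  | deltaStar

/-- The action of a margin operator `Δ^#` on score vectors. -/
def MarginOp.apply {Q : ℕ} : MarginOp → (Fin Q → ℝ) → (Fin Q → ℝ)
  | .delta => marginDelta
  | .deltaStar => marginDeltaStar

/-- The squashing operator `π_γ`, on score vectors. -/
def squash {Q : ℕ} (γ : ℝ) (v : Fin Q → ℝ) : Fin Q → ℝ :=
  fun k => Real.sign (v k) * min |v k| γ

/-- The class `Δ^#_γ G` of the functions `π_γ (Δ^# g)`, for `g` in `G`. -/
def squashedClass {X : Type*} {Q : ℕ} (op : MarginOp) (γ : ℝ) (G : Set (X → Fin Q → ℝ)) :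
    Set (X → Fin Q → ℝ) :=
  (fun g x => squash γ (op.apply (g x))) '' G

/-- The risk of `g`: the expectation of the loss. -/
def risk {X : Type*} [MeasurableSpace X] {Q : ℕ} (P : Measure (X × Fin Q))
    (g : X → Fin Q → ℝ) : ℝ :=
  ∫ z, loss z.2 (g z.1) ∂P

/-- The empirical risk with margin `γ` of `g` on the sample `s`. -/
def empiricalMarginRisk {X : Type*} {Q m : ℕ} (op : MarginOp) (γ : ℝ)
    (s : Fin m → X × Fin Q) (g : X → Fin Q → ℝ) : ℝ :=
  (1 / (m : ℝ)) * ∑ i : Fin m, if op.apply (g (s i).1) (s i).2 < γ then (1 : ℝ) else 0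

/-- `F` is a proper `ε`-net of `S` for the pseudo-metric `ρ`: it is a subset of `S`, and the
open balls of radius `ε` centered in `F` cover `S`. -/
def IsProperNet {E : Type*} (ρ : E → E → ℝ) (ε : ℝ) (S F : Set E) : Prop :=
  F ⊆ S ∧ ∀ f ∈ S, ∃ c ∈ F, ρ f c < ε

/-- The proper covering number: the smallest cardinality of a proper `ε`-net, `⊤` if no proper
`ε`-net is finite. -/
def properCoveringNumber {E : Type*} (ρ : E → E → ℝ) (ε : ℝ) (S : Set E) : ℕ∞ :=
  ⨅ (F : Set E) (_ : IsProperNet ρ ε S F), F.encard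

/-- The pseudo-metric `max_i ‖f (x i) - f' (x i)‖_∞` attached to the points `x i`
(`Fin n → Fin Q → ℝ` carries the maximum distance in both indices). -/
def pointsDist {X : Type*} {Q n : ℕ} (x : Fin n → X) (f f' : X → Fin Q → ℝ) : ℝ :=
  dist (fun i => f (x i)) (fun i => f' (x i))

/-- The uniform proper covering number `N^(p)_{∞,∞}(ε, S, n)`: the supremum, over `n` points
of `X`, of the proper covering numbers for the pseudo-metric attached to these points. -/
def uniformCoveringNumber {X : Type*} {Q : ℕ} (ε : ℝ) (S : Set (X → Fin Q → ℝ)) (n : ℕ) : ℕ∞ :=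
  ⨆ x : Fin n → X, properCoveringNumber (pointsDist x) ε S

/-- The measurability condition on the class `G`, for `n` points drawn from `μ`: each `g` in `G`
is measurable and the set-valued map `x ↦ {(g (x 1), …, g (x n)) : g ∈ G}` is (weakly) measurable,
that is, the points `x` at which it meets a given open set form a measurable set, up to a null
set. Countable classes of measurable functions satisfy it, and so do the classes in
which every function is the pointwise limit of a sequence from a fixed countable subclass. -/
def IsMeasurableClass {X : Type*} [MeasurableSpace X] {Q : ℕ} (μ : Measure X) (n : ℕ)
    (G : Set (X → Fin Q → ℝ)) : Prop :=
  (∀ g ∈ G, Measurable g) ∧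
    ∀ U : Set (Fin n → Fin Q → ℝ), IsOpen U →
      NullMeasurableSet {x : Fin n → X | ∃ g ∈ G, (fun i => g (x i)) ∈ U}
        (Measure.pi fun _ => μ)

end LargeMargin

end

/-!
The bound follows from a deviation inequality at a fixed margin, applied at the margins
`γ = 1/2, 1/4, 1/8, …`.

At a fixed margin `γ`, let `s` be the sample, `s'` an independent copy, and compare the number of
errors of `g` on `s'` with the number of margin errors (`Δ g ≤ γ`) of `g` on `s`. By Jensen's
inequality, averaging the exponential of a multiple of the supremum over `g` of the difference
over `s'` bounds the exponential of the same multiple of the true deviation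
(`ofReal_exp_le_lintegral_expSup`). The law of `(s, s')` is invariant under exchanging `s i` and
`s' i`, and a `γ / 2`-net of the squashed class at the `2 * m` points is unaffected by these
exchanges. Thresholding a member of the net at `γ / 2` gives at least the errors on `s'` and at
most the margin errors on `s`, so the exponential moment is at most the size of the net times that
of a Rademacher sum (`expSup_le`, `lintegral_expSup_le`). Markov's inequality then yields the bound
`N * exp (-m * ε ^ 2 / 2)` (`measure_exists_risk_ge_le`). This route loses neither the factor `2`
nor the term `1 / m` of symmetrization in probability, both of which the stated bound contains.

Measurability of the supremum is delicate: only the hits of *open* sets by the values of the class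
are known to be null measurable, while `Δ g ≤ 0` is a closed condition. It is replaced by the limit
of the conditions `Δ g < 1 / (n + 1)`, each with its own `g` (`limitHitSet`). As the net is
finite, one of its members is close to the functions `g` of infinitely many `n`, which gives the
non-strict inequality `f ≤ γ / 2` for that member. The other condition, `γ < Δ g`, has to be open
as it stands; this costs nothing, since the margins `γ ∈ (r, 2 * r]` handled by the inequality at
`r` are strictly larger than `r`.

Both operators agree with `Δ` where `Δ` is positive and are nonpositive elsewhere
(`MarginOp.apply_of_pos`, `MarginOp.apply_nonpos`), so that `Δ*` enters only through the covering
numbers. These are monotone in the margin because squashing is a contraction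
(`uniformCoveringNumber_squashedClass_le`).
-/

namespace LargeMargin

open scoped ENNReal

/-! ### Symmetrization of exponential moments -/

section Symmetrization

variable {Z : Type*} {m : ℕ}

/-- The double samples `(s, s')` for which some `d ∈ D` exceeds `γ` on the points of `s` with
indices in `J` and is less than `η` on the points of `s'` with indices in `I`. -/
def hitSet (D : Set (Z → ℝ)) (γ η : ℝ) (I J : Finset (Fin m)) :
    Set ((Fin m → Z) × (Fin m → Z)) :=
  {p | ∃ d ∈ D, (∀ j ∈ J, γ < d (p.1 j)) ∧ ∀ i ∈ I, d (p.2 i) < η}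

/-- The limit of `hitSet D γ η I J` as `η` decreases to `0`. It stands in for the condition
`d ≤ 0`, which is closed and so need not define a measurable set of double samples. -/
def limitHitSet (D : Set (Z → ℝ)) (γ : ℝ) (I J : Finset (Fin m)) :
    Set ((Fin m → Z) × (Fin m → Z)) :=
  ⋂ n : ℕ, hitSet D γ (1 / ((n : ℝ) + 1)) I J

/-- A measurable majorant of the supremum over `d ∈ D` of
`exp (t * (#{i | d (s' i) ≤ 0} - #{i | d (s i) ≤ γ}))`. -/
noncomputable def expSup (D : Set (Z → ℝ)) (γ t : ℝ) (p : (Fin m → Z) × (Fin m → Z)) : ℝ≥0∞ :=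
  ⨆ IJ : Finset (Fin m) × Finset (Fin m),
    (limitHitSet D γ IJ.1 IJ.2).indicator
      (fun _ => ENNReal.ofReal (Real.exp (t * (IJ.1.card + IJ.2.card - m)))) p

/-- Exchange the `i`-th points of the two halves of a double sample whenever `σ i` is true. -/
def swapHalves (σ : Fin m → Bool) (p : (Fin m → Z) × (Fin m → Z)) :
    (Fin m → Z) × (Fin m → Z) :=
  (fun i => if σ i then p.2 i else p.1 i, fun i => if σ i then p.1 i else p.2 i)

/-- At the point `z`, thresholding `f` at `γ / 2` is compatible with `d`: the error of `f` is less
than `γ / 2` where it matters. Negative values of `d` are identified with `0`, so that the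
condition does not distinguish the two margin operators. -/
def ThresholdClose (γ : ℝ) (d f : Z → ℝ) (z : Z) : Prop :=
  f z < γ / 2 + max (d z) 0 ∧ (γ < d z → γ / 2 < f z)

lemma le_expSup {D : Set (Z → ℝ)} {γ t : ℝ} {d : Z → ℝ} (hd : d ∈ D)
    (p : (Fin m → Z) × (Fin m → Z)) :
    ENNReal.ofReal (Real.exp (t * ((∑ i, if d (p.2 i) ≤ 0 then (1 : ℝ) else 0) -
      ∑ i, if d (p.1 i) ≤ γ then (1 : ℝ) else 0))) ≤ expSup D γ t p := by
  classical
  set I : Finset (Fin m) := Finset.univ.filter fun i => d (p.2 i) ≤ 0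
  set J : Finset (Fin m) := Finset.univ.filter fun i => ¬ d (p.1 i) ≤ γ
  refine le_trans (le_of_eq ?_) (le_iSup _ (I, J))
  have hmem : p ∈ limitHitSet D γ I J := by
    refine Set.mem_iInter.2 fun n => ⟨d, hd, fun j hj => ?_, fun i hi => ?_⟩
    · exact not_le.1 (Finset.mem_filter.1 hj).2
    · exact lt_of_le_of_lt (Finset.mem_filter.1 hi).2 (by positivity)
  have hcard := Finset.card_filter_add_card_filter_not (s := (Finset.univ : Finset (Fin m)))
    (fun i => d (p.1 i) ≤ γ)
  have hcard' : ((Finset.univ.filter fun i => d (p.1 i) ≤ γ).card : ℝ) + J.card = m := by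
    have : (Finset.univ.filter fun i => d (p.1 i) ≤ γ).card + J.card = m := by
      simpa only [Finset.card_univ, Fintype.card_fin] using hcard
    exact_mod_cast this
  rw [Set.indicator_of_mem hmem, Finset.sum_boole, Finset.sum_boole]
  congr 3
  change (I.card : ℝ) - _ = I.card + J.card - m
  linarith

/-- Up to the limit in `η`, a member of a finite net carries the counts of every `d ∈ D`. -/
lemma expSup_le {D : Set (Z → ℝ)} {γ t : ℝ} (ht : 0 ≤ t) (F : Finset (Z → ℝ))
    (p : (Fin m → Z) × (Fin m → Z))
    (hF : ∀ d ∈ D, ∃ f ∈ F, ∀ i, ThresholdClose γ d f (p.1 i) ∧ ThresholdClose γ d f (p.2 i)) :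
    expSup D γ t p ≤ ∑ f ∈ F, ENNReal.ofReal (Real.exp (t *
      ∑ i, ((if f (p.2 i) ≤ γ / 2 then (1 : ℝ) else 0) -
        if f (p.1 i) ≤ γ / 2 then (1 : ℝ) else 0))) := by
  classical
  refine iSup_le fun ⟨I, J⟩ => ?_
  by_cases hp : p ∈ limitHitSet D γ I J
  swap
  · rw [Set.indicator_of_notMem hp]
    exact zero_le
  rw [Set.indicator_of_mem hp]
  have hn := fun n : ℕ => Set.mem_iInter.1 hp n
  choose d hdD hdJ hdI using hn
  choose f hfF hf using fun n => hF (d n) (hdD n)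
  -- The net is finite, so one of its members serves for arbitrarily small `η`.
  obtain ⟨f₀, hf₀⟩ := Finite.exists_infinite_fiber fun n => (⟨f n, hfF n⟩ : F)
  have hinf : ((fun n => (⟨f n, hfF n⟩ : F)) ⁻¹' {f₀}).Infinite := Set.infinite_coe_iff.1 hf₀
  have heq : ∀ n ∈ (fun n => (⟨f n, hfF n⟩ : F)) ⁻¹' {f₀}, f n = f₀.1 := fun n hn =>
    congrArg Subtype.val hn
  have hI : ∀ i ∈ I, f₀.1 (p.2 i) ≤ γ / 2 := by
    intro i hi
    refine le_of_forall_pos_lt_add fun η hη => ?_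
    obtain ⟨k, hk⟩ := exists_nat_one_div_lt hη
    obtain ⟨n, hn, hkn⟩ := hinf.exists_gt k
    rw [← heq n hn]
    have h1 := ((hf n i).2).1
    have h2 : (1 : ℝ) / ((n : ℝ) + 1) ≤ 1 / ((k : ℝ) + 1) := by gcongr
    have h3 : max (d n (p.2 i)) 0 ≤ 1 / ((n : ℝ) + 1) :=
      max_le (hdI n i hi).le (by positivity)
    linarith
  have hJ : ∀ j ∈ J, γ / 2 < f₀.1 (p.1 j) := by
    intro j hj
    obtain ⟨n, hn⟩ := hinf.nonempty
    rw [← heq n hn]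
    exact (hf n j).1.2 (hdJ n j hj)
  refine le_trans ?_ (Finset.single_le_sum (fun _ _ => zero_le) f₀.2)
  refine ENNReal.ofReal_le_ofReal (Real.exp_le_exp.2 (mul_le_mul_of_nonneg_left ?_ ht))
  have hsum : ((I.card : ℝ) + J.card - m) =
      ∑ i : Fin m, ((if i ∈ I then (1 : ℝ) else 0) + (if i ∈ J then (1 : ℝ) else 0) - 1) := by
    simp [Finset.sum_sub_distrib, Finset.sum_add_distrib]
  change ((I.card : ℝ) + J.card - m) ≤ _
  rw [hsum]
  refine Finset.sum_le_sum fun i _ => ?_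
  have h1 := hI i
  have h2 := hJ i
  by_cases hiI : i ∈ I <;> by_cases hiJ : i ∈ J <;> simp only [hiI, hiJ, if_true, if_false]
  · rw [if_pos (h1 hiI), if_neg (not_le.2 (h2 hiJ))]; norm_num
  · rw [if_pos (h1 hiI)]; split_ifs <;> norm_num
  · rw [if_neg (not_le.2 (h2 hiJ))]; split_ifs <;> norm_num
  · split_ifs <;> norm_num

/-- The exponential moment of a Rademacher sum with coefficients in `[-1, 1]`. -/
lemma sum_exp_signs_le (t : ℝ) (c : Fin m → ℝ) (hc : ∀ i, |c i| ≤ 1) :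
    ∑ σ : Fin m → Bool, Real.exp (t * ∑ i, if σ i then -c i else c i) ≤
      2 ^ m * Real.exp (m * t ^ 2 / 2) := by
  have h1 : ∀ σ : Fin m → Bool, Real.exp (t * ∑ i, if σ i then -c i else c i) =
      ∏ i, Real.exp (t * if σ i then -c i else c i) := fun σ => by
    rw [Finset.mul_sum, Real.exp_sum]
  simp_rw [h1]
  have h2 := Finset.prod_univ_sum (fun _ : Fin m => (Finset.univ : Finset Bool))
    (fun i b => Real.exp (t * if b then -c i else c i))
  rw [Fintype.piFinset_univ] at h2
  rw [← h2]
  calc ∏ i : Fin m, ∑ b : Bool, Real.exp (t * if b then -c i else c i)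
      ≤ ∏ _i : Fin m, (2 * Real.exp (t ^ 2 / 2)) := by
        refine Finset.prod_le_prod (fun i _ => by positivity) fun i _ => ?_
        have h3 : ∑ b : Bool, Real.exp (t * if b then -c i else c i) =
            2 * Real.cosh (t * c i) := by
          rw [Real.cosh_eq]; simp; ring
        rw [h3]
        have h4 := Real.cosh_le_exp_half_sq (t * c i)
        have h5 : (t * c i) ^ 2 / 2 ≤ t ^ 2 / 2 := by
          have : c i ^ 2 ≤ 1 := (sq_le_one_iff_abs_le_one _).2 (hc i)
          rw [mul_pow]
          nlinarith [sq_nonneg t]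
        have := Real.exp_le_exp.2 h5
        linarith
    _ = 2 ^ m * Real.exp (m * t ^ 2 / 2) := by
        rw [Finset.prod_const, Finset.card_univ, Fintype.card_fin, mul_pow, ← Real.exp_nat_mul]
        congr 2
        ring

/-- For a fixed double sample, the random swaps leave the net unchanged, so the maximal
exponential moment is at most that of a Rademacher sum times the size of the net. -/
lemma sum_expSup_swapHalves_le {D : Set (Z → ℝ)} {γ t : ℝ} (ht : 0 ≤ t) {N : ℕ}
    (F : Finset (Z → ℝ)) (hFN : F.card ≤ N) (p : (Fin m → Z) × (Fin m → Z))
    (hF : ∀ d ∈ D, ∃ f ∈ F, ∀ i, ThresholdClose γ d f (p.1 i) ∧ ThresholdClose γ d f (p.2 i)) :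
    ∑ σ : Fin m → Bool, expSup D γ t (swapHalves σ p) ≤
      ENNReal.ofReal (N * (2 ^ m * Real.exp (m * t ^ 2 / 2))) := by
  have hσ : ∀ σ : Fin m → Bool, expSup D γ t (swapHalves σ p) ≤
      ∑ f ∈ F, ENNReal.ofReal (Real.exp (t * ∑ i, if σ i then
        -((if f (p.2 i) ≤ γ / 2 then (1 : ℝ) else 0) - if f (p.1 i) ≤ γ / 2 then (1 : ℝ) else 0)
        else (if f (p.2 i) ≤ γ / 2 then (1 : ℝ) else 0) -
          if f (p.1 i) ≤ γ / 2 then (1 : ℝ) else 0)) := by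
    intro σ
    refine (expSup_le ht F _ ?_).trans (le_of_eq ?_)
    · intro d hd
      obtain ⟨f, hf, h⟩ := hF d hd
      refine ⟨f, hf, fun i => ?_⟩
      cases hi : σ i
      · simpa [swapHalves, hi] using h i
      · simpa [swapHalves, hi] using (h i).symm
    · refine Finset.sum_congr rfl fun f _ => ?_
      congr 3
      refine Finset.sum_congr rfl fun i _ => ?_
      cases hi : σ i <;> simp [swapHalves, hi]
  calc _ ≤ ∑ σ : Fin m → Bool, ∑ f ∈ F, _ := Finset.sum_le_sum fun σ _ => hσ σ
    _ = ∑ f ∈ F, ∑ σ : Fin m → Bool, _ := Finset.sum_comm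
    _ ≤ ∑ _f ∈ F, ENNReal.ofReal (2 ^ m * Real.exp (m * t ^ 2 / 2)) := by
        refine Finset.sum_le_sum fun f _ => ?_
        rw [← ENNReal.ofReal_sum_of_nonneg fun _ _ => (Real.exp_pos _).le]
        refine ENNReal.ofReal_le_ofReal (sum_exp_signs_le t _ fun i => ?_)
        split_ifs <;> norm_num
    _ ≤ ENNReal.ofReal (N * (2 ^ m * Real.exp (m * t ^ 2 / 2))) := by
        rw [Finset.sum_const, nsmul_eq_mul, ENNReal.ofReal_mul (Nat.cast_nonneg _),
          ENNReal.ofReal_natCast]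
        gcongr

variable [MeasurableSpace Z]

lemma aemeasurable_expSup {D : Set (Z → ℝ)} {γ t : ℝ}
    {ν : Measure ((Fin m → Z) × (Fin m → Z))}
    (hD : ∀ (I J : Finset (Fin m)) (η : ℝ), 0 < η → NullMeasurableSet (hitSet D γ η I J) ν) :
    AEMeasurable (expSup D γ t) ν := by
  unfold expSup
  refine AEMeasurable.iSup fun IJ => ?_
  refine aemeasurable_const.indicator₀ (NullMeasurableSet.iInter fun n => ?_)
  exact hD _ _ _ (by positivity)

lemma measurePreserving_swapHalves (P : Measure Z) [IsProbabilityMeasure P] (σ : Fin m → Bool) :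
    MeasurePreserving (swapHalves (Z := Z) σ)
      ((Measure.pi fun _ => P).prod (Measure.pi fun _ => P))
      ((Measure.pi fun _ => P).prod (Measure.pi fun _ => P)) := by
  have he := measurePreserving_arrowProdEquivProdArrow Z Z (Fin m) (fun _ => P) (fun _ => P)
  have hsw : MeasurePreserving
      (fun (w : Fin m → Z × Z) i => (if σ i then Prod.swap else id) (w i))
      (Measure.pi fun _ => P.prod P) (Measure.pi fun _ => P.prod P) := by
    refine measurePreserving_pi _ _ fun i => ?_
    cases σ i
    · exact MeasurePreserving.id _
    · exact Measure.measurePreserving_swap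
  have h := (he.comp hsw).comp he.symm
  convert h using 1
  funext p
  refine Prod.ext (funext fun i => ?_) (funext fun i => ?_) <;>
    cases hi : σ i <;>
    simp [swapHalves, hi, MeasurableEquiv.arrowProdEquivProdArrow, Equiv.arrowProdEquivProdArrow]

lemma lintegral_expSup_le (P : Measure Z) [IsProbabilityMeasure P] {D : Set (Z → ℝ)}
    {γ t : ℝ} (ht : 0 ≤ t) {N : ℕ}
    (hD : ∀ (I J : Finset (Fin m)) (η : ℝ), 0 < η → NullMeasurableSet (hitSet D γ η I J)
      ((Measure.pi fun _ => P).prod (Measure.pi fun _ => P)))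
    (hN : ∀ p : (Fin m → Z) × (Fin m → Z), ∃ F : Finset (Z → ℝ), F.card ≤ N ∧
      ∀ d ∈ D, ∃ f ∈ F, ∀ i, ThresholdClose γ d f (p.1 i) ∧ ThresholdClose γ d f (p.2 i)) :
    ∫⁻ p, expSup D γ t p ∂((Measure.pi fun _ : Fin m => P).prod (Measure.pi fun _ => P)) ≤
      ENNReal.ofReal (N * Real.exp (m * t ^ 2 / 2)) := by
  set ν := (Measure.pi fun _ : Fin m => P).prod (Measure.pi fun _ : Fin m => P)
  have hmeas : AEMeasurable (expSup D γ t) ν := aemeasurable_expSup hD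
  have hσ : ∀ σ : Fin m → Bool, ∫⁻ p, expSup D γ t (swapHalves σ p) ∂ν =
      ∫⁻ p, expSup D γ t p ∂ν := by
    intro σ
    have hmp : MeasurePreserving (swapHalves σ) ν ν := measurePreserving_swapHalves P σ
    rw [← lintegral_map' (by rw [hmp.map_eq]; exact hmeas) hmp.measurable.aemeasurable,
      hmp.map_eq]
  have hsum : (2 : ℝ≥0∞) ^ m * ∫⁻ p, expSup D γ t p ∂ν ≤
      ENNReal.ofReal (N * (2 ^ m * Real.exp (m * t ^ 2 / 2))) := by
    calc (2 : ℝ≥0∞) ^ m * ∫⁻ p, expSup D γ t p ∂ν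
        = ∑ σ : Fin m → Bool, ∫⁻ p, expSup D γ t (swapHalves σ p) ∂ν := by
          simp [hσ]
      _ = ∫⁻ p, ∑ σ : Fin m → Bool, expSup D γ t (swapHalves σ p) ∂ν := by
          rw [lintegral_finsetSum']
          exact fun σ _ => hmeas.comp_quasiMeasurePreserving
            (measurePreserving_swapHalves P σ).quasiMeasurePreserving
      _ ≤ ∫⁻ _, ENNReal.ofReal (N * (2 ^ m * Real.exp (m * t ^ 2 / 2))) ∂ν := by
          refine lintegral_mono fun p => ?_
          obtain ⟨F, hFN, hF⟩ := hN p
          exact sum_expSup_swapHalves_le ht F hFN p hF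
      _ = _ := by simp
  have h2 : ENNReal.ofReal (N * (2 ^ m * Real.exp (m * t ^ 2 / 2))) =
      2 ^ m * ENNReal.ofReal (N * Real.exp (m * t ^ 2 / 2)) := by
    rw [mul_left_comm, ENNReal.ofReal_mul (by positivity), ENNReal.ofReal_pow (by norm_num)]
    simp
  rw [h2] at hsum
  exact (ENNReal.mul_le_mul_iff_right (by simp) (by simp)).1 hsum

/-- Jensen's inequality over the second half of the double sample: averaging the exponential
replaces the empirical risk there by the risk. -/
lemma ofReal_exp_le_lintegral_expSup (P : Measure Z) [IsProbabilityMeasure P]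
    {D : Set (Z → ℝ)} {γ t : ℝ} {d : Z → ℝ} (hd : d ∈ D) (hdm : Measurable d) (s : Fin m → Z) :
    ENNReal.ofReal (Real.exp (t * (m * P.real {z | d z ≤ 0} -
      ∑ i, if d (s i) ≤ γ then (1 : ℝ) else 0))) ≤
      ∫⁻ s', expSup D γ t (s, s') ∂(Measure.pi fun _ : Fin m => P) := by
  set ν := Measure.pi fun _ : Fin m => P
  set a := ∑ i, if d (s i) ≤ γ then (1 : ℝ) else 0
  have hset : MeasurableSet {z | d z ≤ 0} := measurableSet_le hdm measurable_const
  have hb : ∀ i : Fin m, Integrable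
      (fun s' : Fin m → Z => if d (s' i) ≤ 0 then (1 : ℝ) else 0) ν := by
    intro i
    have : Measurable (fun s' : Fin m → Z => if d (s' i) ≤ 0 then (1 : ℝ) else 0) :=
      Measurable.ite (measurableSet_le (hdm.comp (measurable_pi_apply i)) measurable_const)
        measurable_const measurable_const
    refine Integrable.of_bound this.aestronglyMeasurable 1 (Filter.Eventually.of_forall fun s' => ?_)
    split_ifs <;> simp
  set X : (Fin m → Z) → ℝ := fun s' => t * ((∑ i, if d (s' i) ≤ 0 then (1 : ℝ) else 0) - a)
  have hXint : Integrable X ν :=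
    ((integrable_finsetSum _ fun i _ => hb i).sub (integrable_const _)).const_mul _
  have hXbd : ∀ s', |X s'| ≤ |t| * (m + |a|) := by
    intro s'
    simp only [X, abs_mul]
    gcongr
    refine (abs_sub _ _).trans ?_
    gcongr
    rw [Finset.sum_boole, Nat.abs_cast]
    exact_mod_cast (Finset.card_le_univ _).trans (by simp)
  have hexp : Integrable (fun s' => Real.exp (X s')) ν := by
    refine Integrable.of_bound (Real.continuous_exp.comp_aestronglyMeasurable
      hXint.aestronglyMeasurable) (Real.exp (|t| * (m + |a|)))
      (Filter.Eventually.of_forall fun s' => ?_)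
    rw [Real.norm_eq_abs, Real.abs_exp]
    exact Real.exp_le_exp.2 ((le_abs_self _).trans (hXbd s'))
  have hmean : ∫ s', X s' ∂ν = t * (m * P.real {z | d z ≤ 0} - a) := by
    have hi : ∀ i : Fin m, ∫ s' : Fin m → Z, (if d (s' i) ≤ 0 then (1 : ℝ) else 0) ∂ν =
        P.real {z | d z ≤ 0} := by
      intro i
      have h1 := integral_indicator_one (μ := ν)
        ((measurable_pi_apply (X := fun _ : Fin m => Z) i) hset)
      have hmp := measurePreserving_eval (fun _ : Fin m => P) i
      have h2 : ν.real (Function.eval i ⁻¹' {z | d z ≤ 0}) = P.real {z | d z ≤ 0} := by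
        rw [measureReal_def, measureReal_def, hmp.measure_preimage hset.nullMeasurableSet]
      rw [← h2, ← h1]
      rfl
    simp only [X]
    rw [integral_const_mul, integral_sub (integrable_finsetSum _ fun i _ => hb i)
      (integrable_const _), integral_finsetSum _ fun i _ => hb i]
    simp [hi]
  have hjensen := convexOn_exp.map_integral_le (μ := ν) Real.continuous_exp.continuousOn
    isClosed_univ (Filter.Eventually.of_forall fun _ => Set.mem_univ _) hXint hexp
  rw [hmean] at hjensen
  refine (ENNReal.ofReal_le_ofReal hjensen).trans ?_
  rw [ofReal_integral_eq_lintegral_ofReal hexp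
    (Filter.Eventually.of_forall fun _ => (Real.exp_pos _).le)]
  exact lintegral_mono fun s' => le_expSup hd (s, s')

/-- The deviation inequality at a fixed margin. The set of bad samples need not be measurable;
the bound is on its outer measure. -/
theorem measure_exists_risk_ge_le (P : Measure Z) [IsProbabilityMeasure P] (hm : 1 ≤ m)
    {D : Set (Z → ℝ)} (hDm : ∀ d ∈ D, Measurable d) {γ ε : ℝ} (hε : 0 ≤ ε) {N : ℕ}
    (hD : ∀ (I J : Finset (Fin m)) (η : ℝ), 0 < η → NullMeasurableSet (hitSet D γ η I J)
      ((Measure.pi fun _ => P).prod (Measure.pi fun _ => P)))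
    (hN : ∀ p : (Fin m → Z) × (Fin m → Z), ∃ F : Finset (Z → ℝ), F.card ≤ N ∧
      ∀ d ∈ D, ∃ f ∈ F, ∀ i, ThresholdClose γ d f (p.1 i) ∧ ThresholdClose γ d f (p.2 i)) :
    (Measure.pi fun _ : Fin m => P) {s | ∃ d ∈ D,
      (1 / (m : ℝ)) * (∑ i, if d (s i) ≤ γ then (1 : ℝ) else 0) + ε ≤ P.real {z | d z ≤ 0}} ≤
      ENNReal.ofReal (N * Real.exp (-(m * ε ^ 2 / 2))) := by
  set ν := Measure.pi fun _ : Fin m => P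
  have hm0 : (0 : ℝ) < m := by exact_mod_cast hm
  have hmeas : AEMeasurable (expSup D γ ε) (ν.prod ν) := aemeasurable_expSup hD
  set H : (Fin m → Z) → ℝ≥0∞ := fun s => ∫⁻ s', expSup D γ ε (s, s') ∂ν
  have hH : AEMeasurable H ν := hmeas.lintegral_prod_right'
  -- The exponent `t = ε` minimizes `m * t ^ 2 / 2 - t * m * ε`.
  set K := ENNReal.ofReal (Real.exp (ε * (m * ε)))
  have hK0 : K ≠ 0 := by simp [K, Real.exp_pos]
  have hKtop : K ≠ ∞ := ENNReal.ofReal_ne_top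
  have hsub : {s | ∃ d ∈ D, (1 / (m : ℝ)) * (∑ i, if d (s i) ≤ γ then (1 : ℝ) else 0) + ε ≤
      P.real {z | d z ≤ 0}} ⊆ {s | K ≤ H s} := by
    rintro s ⟨d, hd, hs⟩
    refine le_trans (ENNReal.ofReal_le_ofReal (Real.exp_le_exp.2
      (mul_le_mul_of_nonneg_left ?_ hε))) (ofReal_exp_le_lintegral_expSup P hd (hDm d hd) s)
    have := mul_le_mul_of_nonneg_left hs hm0.le
    rw [mul_add, ← mul_assoc, mul_one_div_cancel hm0.ne', one_mul] at this
    linarith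
  have hmarkov := mul_meas_ge_le_lintegral₀ hH K
  have hHint : ∫⁻ s, H s ∂ν ≤ ENNReal.ofReal (N * Real.exp (m * ε ^ 2 / 2)) := by
    rw [← lintegral_prod _ hmeas]
    exact lintegral_expSup_le P hε hD hN
  have hfac : ENNReal.ofReal (N * Real.exp (m * ε ^ 2 / 2)) =
      K * ENNReal.ofReal (N * Real.exp (-(m * ε ^ 2 / 2))) := by
    rw [← ENNReal.ofReal_mul (Real.exp_pos _).le, mul_left_comm, ← Real.exp_add]
    congr 3
    ring
  rw [hfac] at hHint
  exact (measure_mono hsub).trans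
    ((ENNReal.mul_le_mul_iff_right hK0 hKtop).1 (hmarkov.trans hHint))

end Symmetrization

/-! ### The margin operators and squashing -/

section MarginOperators

variable {Q : ℕ}

lemma le_maxOther (v : Fin Q → ℝ) {k l : Fin Q} (h : l ≠ k) : v l ≤ maxOther v k :=
  le_ciSup (f := fun l : {l : Fin Q // l ≠ k} => v l) (Set.finite_range _).bddAbove ⟨l, h⟩

lemma continuous_maxOther (k : Fin Q) : Continuous fun v : Fin Q → ℝ => maxOther v k := by
  unfold maxOther
  rcases isEmpty_or_nonempty {l : Fin Q // l ≠ k} with h | h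
  · simp only [Real.iSup_of_isEmpty]
    exact continuous_const
  · simp_rw [← Finset.sup'_univ_eq_ciSup]
    exact Continuous.finset_sup'_apply _ fun i _ => continuous_apply _

lemma continuous_marginDelta (k : Fin Q) : Continuous fun v : Fin Q → ℝ => marginDelta v k :=
  continuous_const.mul ((continuous_apply k).sub (continuous_maxOther k))

lemma marginDelta_nonpos_iff (v : Fin Q → ℝ) (k : Fin Q) :
    marginDelta v k ≤ 0 ↔ v k ≤ maxOther v k := by
  unfold marginDelta
  constructor <;> intro h <;> linarith

lemma marginDelta_le_of_pos {v : Fin Q → ℝ} {k : Fin Q} (h : 0 < marginDelta v k) (j : Fin Q) :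
    marginDelta v j ≤ marginDelta v k := by
  by_cases hjk : j = k
  · rw [hjk]
  · refine le_trans ((marginDelta_nonpos_iff v j).2 ?_) h.le
    have h1 : maxOther v k < v k := by
      by_contra hc
      exact absurd ((marginDelta_nonpos_iff v k).2 (not_lt.1 hc)) (not_le.2 h)
    exact ((le_maxOther v hjk).trans h1.le).trans (le_maxOther v (Ne.symm hjk))

lemma iSup_marginDelta_nonneg (hQ : 2 ≤ Q) (v : Fin Q → ℝ) : 0 ≤ ⨆ j, marginDelta v j := by
  have : Nontrivial (Fin Q) := Fin.nontrivial_iff_two_le.2 hQ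
  obtain ⟨k, hk⟩ := Finite.exists_max v
  have : Nonempty {l : Fin Q // l ≠ k} := (exists_ne k).elim fun l hl => ⟨⟨l, hl⟩⟩
  have h : maxOther v k ≤ v k := ciSup_le fun l => hk l
  refine le_trans ?_ (le_ciSup (Set.finite_range fun j => marginDelta v j).bddAbove k)
  unfold marginDelta
  linarith

/-- Both margin operators agree with `Δ` where `Δ` is positive. -/
lemma MarginOp.apply_of_pos (op : MarginOp) {v : Fin Q → ℝ} {k : Fin Q}
    (h : 0 < marginDelta v k) : op.apply v k = marginDelta v k := by
  cases op
  · rfl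
  · have : Nonempty (Fin Q) := ⟨k⟩
    have hsup : ⨆ j, marginDelta v j = marginDelta v k :=
      le_antisymm (ciSup_le (marginDelta_le_of_pos h))
        (le_ciSup (Set.finite_range fun j => marginDelta v j).bddAbove k)
    change Real.sign (marginDelta v k) * (⨆ j, marginDelta v j) = _
    rw [hsup, Real.sign_of_pos h, one_mul]

lemma MarginOp.apply_nonpos (hQ : 2 ≤ Q) (op : MarginOp) {v : Fin Q → ℝ} {k : Fin Q}
    (h : marginDelta v k ≤ 0) : op.apply v k ≤ 0 := by
  cases op
  · exact h
  · change Real.sign (marginDelta v k) * (⨆ j, marginDelta v j) ≤ 0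
    refine mul_nonpos_of_nonpos_of_nonneg ?_ (iSup_marginDelta_nonneg hQ v)
    rcases h.lt_or_eq with h | h
    · rw [Real.sign_of_neg h]; norm_num
    · rw [h, Real.sign_zero]

lemma squash_eq_max_min {γ : ℝ} (hγ : 0 ≤ γ) (v : Fin Q → ℝ) (k : Fin Q) :
    squash γ v k = max (min (v k) γ) (-γ) := by
  unfold squash
  rcases lt_trichotomy (v k) 0 with h | h | h
  · rw [Real.sign_of_neg h, abs_of_neg h, min_eq_left (h.le.trans hγ), neg_one_mul,
      ← max_neg_neg, neg_neg]
  · simp [h, hγ]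
  · rw [Real.sign_of_pos h, abs_of_pos h, one_mul, max_eq_left]
    exact (neg_nonpos.2 hγ).trans (le_min h.le hγ)

lemma squash_squash {γ γ' : ℝ} (hγ : 0 ≤ γ) (h : γ ≤ γ') (v : Fin Q → ℝ) :
    squash γ (squash γ' v) = squash γ v := by
  funext k
  rw [squash_eq_max_min hγ, squash_eq_max_min (hγ.trans h), squash_eq_max_min hγ]
  rw [min_max_distrib_right, min_assoc, min_eq_right h, max_assoc]
  congr 1
  rw [min_eq_left (by linarith), max_eq_right (by linarith)]

lemma dist_squash_le {γ : ℝ} (hγ : 0 ≤ γ) (v w : Fin Q → ℝ) :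
    dist (squash γ v) (squash γ w) ≤ dist v w := by
  refine (dist_pi_le_iff dist_nonneg).2 fun k => ?_
  rw [squash_eq_max_min hγ, squash_eq_max_min hγ]
  refine le_trans ?_ (dist_le_pi_dist v w k)
  rw [Real.dist_eq, Real.dist_eq]
  refine (abs_max_sub_max_le_abs _ _ _).trans ((abs_min_sub_min_le_max _ _ _ _).trans ?_)
  simp

end MarginOperators

/-! ### Covering numbers and threshold nets -/

section CoveringNumbers

variable {X : Type*} {Q : ℕ}

/-- Squashing at a smaller margin is a contraction, so it maps proper nets to proper nets. -/
lemma uniformCoveringNumber_squashedClass_le (op : MarginOp) (G : Set (X → Fin Q → ℝ)) (n : ℕ)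
    {γ γ' ε ε' : ℝ} (hγ : 0 ≤ γ) (hγγ' : γ ≤ γ') (hε : ε' ≤ ε) :
    uniformCoveringNumber ε (squashedClass op γ G) n ≤
      uniformCoveringNumber ε' (squashedClass op γ' G) n := by
  refine iSup_mono fun x => le_iInf₂ fun F hF => ?_
  refine iInf₂_le_of_le ((fun f y => squash γ (f y)) '' F) ⟨?_, ?_⟩ (Set.encard_image_le _ _)
  · rintro _ ⟨f, hf, rfl⟩
    obtain ⟨g, hg, rfl⟩ := hF.1 hf
    exact ⟨g, hg, funext fun y => (squash_squash hγ hγγ' _).symm⟩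
  · rintro _ ⟨g, hg, rfl⟩
    obtain ⟨c, hc, hgc⟩ := hF.2 _ ⟨g, hg, rfl⟩
    refine ⟨_, ⟨c, hc, rfl⟩, lt_of_le_of_lt ?_ (hgc.trans_le hε)⟩
    refine (dist_pi_le_iff dist_nonneg).2 fun i => ?_
    have h1 := dist_squash_le hγ (squash γ' (op.apply (g (x i)))) (c (x i))
    rw [squash_squash hγ hγγ'] at h1
    exact h1.trans (dist_le_pi_dist (fun i => squash γ' (op.apply (g (x i))))
      (fun i => c (x i)) i)

/-- The margin of `g` at a labeled point. Its nonpositivity is the `0`-`1` loss. -/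
noncomputable def labeledMargin (g : X → Fin Q → ℝ) (z : X × Fin Q) : ℝ :=
  marginDelta (g z.1) z.2

/-- The indexing of the union of the two halves of a double sample by `Fin (2 * m)`. -/
def sumFinEquiv (m : ℕ) : Fin m ⊕ Fin m ≃ Fin (2 * m) :=
  finSumFinEquiv.trans (finCongr (two_mul m).symm)

/-- The `2 * m` points of `X` that underlie a double labeled sample. -/
def doublePoints {m : ℕ} (p : (Fin m → X × Fin Q) × (Fin m → X × Fin Q)) : Fin (2 * m) → X :=
  fun i => (Sum.elim p.1 p.2 ((sumFinEquiv m).symm i)).1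

@[simp]
lemma doublePoints_inl {m : ℕ} (p : (Fin m → X × Fin Q) × (Fin m → X × Fin Q)) (i : Fin m) :
    doublePoints p (sumFinEquiv m (Sum.inl i)) = (p.1 i).1 := by
  simp [doublePoints]

@[simp]
lemma doublePoints_inr {m : ℕ} (p : (Fin m → X × Fin Q) × (Fin m → X × Fin Q)) (i : Fin m) :
    doublePoints p (sumFinEquiv m (Sum.inr i)) = (p.2 i).1 := by
  simp [doublePoints]

/-- A squashed function that is `γ / 2`-close to `π_γ (Δ^# g)` at `z.1` thresholds the margin of
`g` correctly. -/
lemma thresholdClose_of_abs_sub_lt (hQ : 2 ≤ Q) (op : MarginOp) {γ : ℝ} (hγ : 0 < γ)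
    (g c : X → Fin Q → ℝ) (z : X × Fin Q)
    (h : |squash γ (op.apply (g z.1)) z.2 - c z.1 z.2| < γ / 2) :
    ThresholdClose γ (labeledMargin g) (fun z => c z.1 z.2) z := by
  rw [squash_eq_max_min hγ.le, abs_lt] at h
  refine ⟨?_, fun hlt => ?_⟩
  · rcases le_or_gt (labeledMargin g z) 0 with hd | hd
    · have h1 := op.apply_nonpos hQ hd
      have h2 : max (min (op.apply (g z.1) z.2) γ) (-γ) ≤ 0 :=
        max_le ((min_le_left _ _).trans h1) (by linarith)
      have h3 := le_max_right (labeledMargin g z) 0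
      linarith
    · rw [op.apply_of_pos hd] at h
      have h2 : max (min (labeledMargin g z) γ) (-γ) ≤ labeledMargin g z :=
        max_le (min_le_left _ _) (by linarith)
      have h3 := le_max_left (labeledMargin g z) 0
      change -(γ / 2) < max (min (labeledMargin g z) γ) (-γ) - _ ∧ _ at h
      linarith
  · rw [op.apply_of_pos (hγ.trans hlt)] at h
    have h2 : max (min (labeledMargin g z) γ) (-γ) - c z.1 z.2 < γ / 2 := h.2
    rw [min_eq_right hlt.le, max_eq_left (by linarith)] at h2
    change γ / 2 < c z.1 z.2
    linarith

lemma exists_finset_thresholdClose (hQ : 2 ≤ Q) (op : MarginOp) {γ : ℝ} (hγ : 0 < γ)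
    (G : Set (X → Fin Q → ℝ)) {m N : ℕ}
    (hN : uniformCoveringNumber (γ / 2) (squashedClass op γ G) (2 * m) ≤ N)
    (p : (Fin m → X × Fin Q) × (Fin m → X × Fin Q)) :
    ∃ F : Finset (X × Fin Q → ℝ), F.card ≤ N ∧ ∀ d ∈ labeledMargin '' G, ∃ f ∈ F, ∀ i,
      ThresholdClose γ d f (p.1 i) ∧ ThresholdClose γ d f (p.2 i) := by
  have h1 : properCoveringNumber (pointsDist (doublePoints p)) (γ / 2) (squashedClass op γ G) <
      (N : ℕ∞) + 1 :=
    ENat.lt_natCast_add_one_iff.2 ((le_iSup (fun x => properCoveringNumber (pointsDist x) (γ / 2)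
      (squashedClass op γ G)) (doublePoints p)).trans hN)
  unfold properCoveringNumber at h1
  simp only [iInf_lt_iff] at h1
  obtain ⟨F, hF, hFN⟩ := h1
  have h2 : ((fun (c : X → Fin Q → ℝ) (z : X × Fin Q) => c z.1 z.2) '' F).encard ≤ N :=
    (Set.encard_image_le _ _).trans (ENat.lt_natCast_add_one_iff.1 hFN)
  obtain ⟨hfin, hcard⟩ := Set.encard_le_coe_iff_finite_ncard_le.1 h2
  refine ⟨hfin.toFinset, by rwa [← Set.ncard_eq_toFinset_card _ hfin], ?_⟩
  rintro _ ⟨g, hg, rfl⟩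
  obtain ⟨c, hc, hgc⟩ := hF.2 _ ⟨g, hg, rfl⟩
  refine ⟨_, hfin.mem_toFinset.2 ⟨c, hc, rfl⟩, ?_⟩
  have hclose : ∀ i k, |squash γ (op.apply (g (doublePoints p i))) k - c (doublePoints p i) k| <
      γ / 2 := fun i k => by
    rw [← Real.dist_eq]
    refine lt_of_le_of_lt (dist_le_pi_dist (squash γ (op.apply (g (doublePoints p i)))) _ k) ?_
    exact lt_of_le_of_lt (dist_le_pi_dist
      (fun i => squash γ (op.apply (g (doublePoints p i)))) (fun i => c (doublePoints p i)) i) hgc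
  intro i
  constructor
  · refine thresholdClose_of_abs_sub_lt hQ op hγ g c _ ?_
    simpa using hclose (sumFinEquiv m (Sum.inl i)) (p.1 i).2
  · refine thresholdClose_of_abs_sub_lt hQ op hγ g c _ ?_
    simpa using hclose (sumFinEquiv m (Sum.inr i)) (p.2 i).2

end CoveringNumbers

/-! ### Measurability of the hit sets -/

section Measurability

variable {X : Type*} [MeasurableSpace X] {Q m : ℕ}

lemma measurable_labeledMargin {g : X → Fin Q → ℝ} (hg : Measurable g) :
    Measurable (labeledMargin g) :=
  measurable_from_prod_countable_left fun k => (continuous_marginDelta k).measurable.comp hg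

lemma risk_eq_measureReal (P : Measure (X × Fin Q)) {g : X → Fin Q → ℝ} (hg : Measurable g) :
    risk P g = P.real {z | labeledMargin g z ≤ 0} := by
  rw [← integral_indicator_one (measurableSet_le (measurable_labeledMargin hg) measurable_const)]
  refine integral_congr_ae (Filter.Eventually.of_forall fun z => ?_)
  simp only [loss, Set.indicator_apply, Set.mem_ofPred_eq, labeledMargin, marginDelta_nonpos_iff,
    Pi.one_apply]

lemma measurePreserving_doublePoints (P : Measure (X × Fin Q)) [IsProbabilityMeasure P] :
    MeasurePreserving (doublePoints (X := X) (Q := Q) (m := m))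
      ((Measure.pi fun _ => P).prod (Measure.pi fun _ => P)) (Measure.pi fun _ => P.fst) := by
  have h1 := measurePreserving_sumPiEquivProdPi_symm (fun _ : Fin m ⊕ Fin m => P)
  have h2 := measurePreserving_piCongrLeft (fun _ : Fin (2 * m) => P) (sumFinEquiv m)
  have h3 : MeasurePreserving (fun (w : Fin (2 * m) → X × Fin Q) i => (w i).1)
      (Measure.pi fun _ => P) (Measure.pi fun _ => P.fst) :=
    measurePreserving_pi _ _ fun _ => ⟨measurable_fst, rfl⟩
  convert h3.comp (h2.comp h1) using 1
  funext p i
  obtain ⟨j, rfl⟩ := (sumFinEquiv m).surjective i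
  simp only [Function.comp_apply, MeasurableEquiv.coe_piCongrLeft, Equiv.piCongrLeft_apply_apply]
  cases j <;> simp [MeasurableEquiv.sumPiEquivProdPi, Equiv.sumPiEquivProdPi]

/-- Once the labels are fixed, a hit set is the set of points at which the values of the class
meet an open set. -/
lemma nullMeasurableSet_hitSet (P : Measure (X × Fin Q)) [IsProbabilityMeasure P]
    {G : Set (X → Fin Q → ℝ)} (hG : IsMeasurableClass P.fst (2 * m) G) (γ η : ℝ)
    (I J : Finset (Fin m)) :
    NullMeasurableSet (hitSet (labeledMargin '' G) γ η I J)
      ((Measure.pi fun _ => P).prod (Measure.pi fun _ => P)) := by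
  let U : (Fin m → Fin Q) → (Fin m → Fin Q) → Set (Fin (2 * m) → Fin Q → ℝ) := fun y y' =>
    (⋂ j ∈ J, {v | γ < marginDelta (v (sumFinEquiv m (Sum.inl j))) (y j)}) ∩
      ⋂ i ∈ I, {v | marginDelta (v (sumFinEquiv m (Sum.inr i))) (y' i) < η}
  have hU : ∀ y y', IsOpen (U y y') := fun y y' => by
    refine IsOpen.inter (isOpen_biInter_finset fun j _ => ?_) (isOpen_biInter_finset fun i _ => ?_)
    · exact isOpen_lt continuous_const ((continuous_marginDelta _).comp (continuous_apply _))
    · exact isOpen_lt ((continuous_marginDelta _).comp (continuous_apply _)) continuous_const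
  have heq : hitSet (labeledMargin '' G) γ η I J = ⋃ y : Fin m → Fin Q, ⋃ y' : Fin m → Fin Q,
      {p | (fun i => (p.1 i).2) = y ∧ (fun i => (p.2 i).2) = y'} ∩
        doublePoints ⁻¹' {x | ∃ g ∈ G, (fun i => g (x i)) ∈ U y y'} := by
    ext p
    simp only [hitSet, U, Set.mem_ofPred_eq, Set.mem_iUnion, Set.mem_inter_iff, Set.mem_preimage,
      Set.mem_iInter, Set.exists_mem_image, doublePoints_inl, doublePoints_inr]
    constructor
    · rintro ⟨g, hg, h1, h2⟩
      exact ⟨_, _, ⟨rfl, rfl⟩, g, hg, h1, h2⟩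
    · rintro ⟨_, _, ⟨rfl, rfl⟩, g, hg, h1, h2⟩
      exact ⟨g, hg, h1, h2⟩
  rw [heq]
  refine NullMeasurableSet.iUnion fun y => NullMeasurableSet.iUnion fun y' => ?_
  refine NullMeasurableSet.inter (MeasurableSet.nullMeasurableSet ?_)
    ((hG.2 _ (hU y y')).preimage (measurePreserving_doublePoints P).quasiMeasurePreserving)
  have h1 : Measurable fun p : (Fin m → X × Fin Q) × (Fin m → X × Fin Q) =>
      fun i => (p.1 i).2 := by fun_prop
  have h2 : Measurable fun p : (Fin m → X × Fin Q) × (Fin m → X × Fin Q) =>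
      fun i => (p.2 i).2 := by fun_prop
  exact (h1 (measurableSet_singleton y)).inter (h2 (measurableSet_singleton y'))

end Measurability

/-! ### The deviation inequality in terms of covering numbers -/

section GuaranteedRisk

variable {X : Type*} [MeasurableSpace X] {Q m : ℕ}

/-- The guaranteed risk at a fixed margin, with confidence `1 - τ`. Margins equal to `γ` count as
errors here, so that the complementary condition `γ < Δ g` is open. -/
lemma measure_exists_risk_ge_le_of_covering (hQ : 2 ≤ Q) (P : Measure (X × Fin Q))
    [IsProbabilityMeasure P] (hm : 1 ≤ m) {G : Set (X → Fin Q → ℝ)}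
    (hG : IsMeasurableClass P.fst (2 * m) G) (op : MarginOp) {γ : ℝ} (hγ : 0 < γ) {N : ℕ}
    (hN : uniformCoveringNumber (γ / 2) (squashedClass op γ G) (2 * m) ≤ N)
    {τ : ℝ} (hτ0 : 0 < τ) (hτ1 : τ ≤ 1) :
    (Measure.pi fun _ : Fin m => P) {s | ∃ g ∈ G,
      (1 / (m : ℝ)) * (∑ i, if labeledMargin g (s i) ≤ γ then (1 : ℝ) else 0) +
        Real.sqrt ((2 / (m : ℝ)) * (Real.log (2 * N) + Real.log (1 / τ))) ≤ risk P g} ≤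
      ENNReal.ofReal τ := by
  set ε := Real.sqrt ((2 / (m : ℝ)) * (Real.log (2 * N) + Real.log (1 / τ))) with hεdef
  have hm0 : (0 : ℝ) < m := by exact_mod_cast hm
  have h := measure_exists_risk_ge_le P hm (D := labeledMargin '' G)
    (Set.forall_mem_image.2 fun g hg => measurable_labeledMargin (hG.1 g hg))
    (γ := γ) (Real.sqrt_nonneg _ : 0 ≤ ε)
    (fun I J η _ => nullMeasurableSet_hitSet P hG γ η I J)
    (exists_finset_thresholdClose hQ op hγ G hN)
  refine (measure_mono ?_).trans (h.trans (ENNReal.ofReal_le_ofReal ?_))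
  · rintro s ⟨g, hg, hs⟩
    rw [risk_eq_measureReal P (hG.1 g hg)] at hs
    exact ⟨_, ⟨g, hg, rfl⟩, hs⟩
  · rcases Nat.eq_zero_or_pos N with h0 | hpos
    · simp [h0, hτ0.le]
    · have hN1 : (1 : ℝ) ≤ N := by exact_mod_cast hpos
      have hlog : 0 ≤ Real.log (2 * N) + Real.log (1 / τ) :=
        add_nonneg (Real.log_nonneg (by linarith))
          (Real.log_nonneg (by rwa [le_div_iff₀ hτ0, one_mul]))
      have hsq : (m : ℝ) * ε ^ 2 / 2 = Real.log (2 * N) + Real.log (1 / τ) := by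
        rw [hεdef, Real.sq_sqrt (by positivity)]
        field_simp
      rw [hsq, Real.exp_neg, Real.exp_add, Real.exp_log (by positivity),
        Real.exp_log (by positivity)]
      have : (N : ℝ) * (2 * N * (1 / τ))⁻¹ = τ / 2 := by field_simp
      rw [this]
      linarith

end GuaranteedRisk

end LargeMargin

/-! ### Stratification over the margin -/

open LargeMargin

theorem theorem1 {X : Type*} [MeasurableSpace X] {Q : ℕ} (hQ : 3 ≤ Q)
    (P : Measure (X × Fin Q)) [IsProbabilityMeasure P]
    (m : ℕ) (hm : 1 ≤ m)
    (G : Set (X → Fin Q → ℝ)) (hG : LargeMargin.IsMeasurableClass P.fst (2 * m) G)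
    {Ω : Type*} [MeasurableSpace Ω] (μ : Measure Ω) [IsProbabilityMeasure μ]
    (s : Fin m → Ω → X × Fin Q) (hs_meas : ∀ i, Measurable (s i))
    (hs_law : ∀ i, μ.map (s i) = P) (hs_indep : iIndepFun s μ)
    (op : LargeMargin.MarginOp) (δ : ℝ) (hδ0 : 0 < δ) (hδ1 : δ < 1) :
    ∃ A : Set Ω, MeasurableSet A ∧ ENNReal.ofReal (1 - δ) ≤ μ A ∧
      ∀ ω ∈ A, ∀ γ : ℝ, 0 < γ → γ ≤ 1 → ∀ g ∈ G,
        -- there is nothing to prove when the covering number is infinite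
        ∀ N : ℕ, LargeMargin.uniformCoveringNumber (γ / 4)
            (LargeMargin.squashedClass op γ G) (2 * m) = (N : ℕ∞) →
          LargeMargin.risk P g ≤
            LargeMargin.empiricalMarginRisk op γ (fun i => s i ω) g +
              Real.sqrt ((2 / (m : ℝ)) *
                (Real.log (2 * (N : ℝ)) + Real.log (2 / (γ * δ)))) +
              1 / (m : ℝ) := by
  have hQ2 : 2 ≤ Q := by omega
  have hm0 : (0 : ℝ) < m := by exact_mod_cast hm
  -- A margin `γ ∈ (0, 1]` lies in exactly one interval `(r n, 2 * r n]`; on it the bound at `γ`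
  -- dominates the bound at `r n`, and the confidence losses `r n * δ` add up to `δ`.
  set r : ℕ → ℝ := fun n => (1 / 2) ^ (n + 1)
  have hr0 : ∀ n, 0 < r n := fun n => by positivity
  have hr1 : ∀ n, r n ≤ 1 := fun n => pow_le_one₀ (by norm_num) (by norm_num)
  -- The bad samples at the margin `r n`, with confidence `1 - r n * δ`.
  set B : ℕ → Set (Fin m → X × Fin Q) := fun n => {x | ∃ N : ℕ,
    uniformCoveringNumber (r n / 2) (squashedClass op (r n) G) (2 * m) = (N : ℕ∞) ∧ ∃ g ∈ G,
      (1 / (m : ℝ)) * (∑ i, if labeledMargin g (x i) ≤ r n then (1 : ℝ) else 0) +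
        Real.sqrt ((2 / (m : ℝ)) * (Real.log (2 * N) + Real.log (1 / (r n * δ)))) ≤ risk P g}
  have hB : ∀ n, (Measure.pi fun _ : Fin m => P) (B n) ≤ ENNReal.ofReal (r n * δ) := by
    intro n
    rcases Set.eq_empty_or_nonempty (B n) with hempty | ⟨_, N, hN, _⟩
    · simp [hempty]
    · refine (measure_mono ?_).trans (measure_exists_risk_ge_le_of_covering hQ2 P hm hG op (hr0 n)
        hN.le (mul_pos (hr0 n) hδ0) (mul_le_one₀ (hr1 n) hδ0.le hδ1.le))
      rintro x ⟨N', hN', hx⟩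
      rw [hN, ENat.natCast_inj] at hN'
      rwa [← hN'] at hx
  have hsmeas : Measurable fun ω i => s i ω := measurable_pi_lambda _ hs_meas
  have hmap : μ.map (fun ω i => s i ω) = Measure.pi fun _ => P := by
    rw [(iIndepFun_iff_map_fun_eq_pi_map fun i => (hs_meas i).aemeasurable).1 hs_indep]
    simp_rw [hs_law]
  set C : Set Ω := (fun ω i => s i ω) ⁻¹' ⋃ n, B n
  have hC : μ C ≤ ENNReal.ofReal δ := by
    calc μ C ≤ (Measure.pi fun _ : Fin m => P) (⋃ n, B n) := by
          rw [← hmap]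
          exact Measure.le_map_apply hsmeas.aemeasurable _
      _ ≤ ∑' n, (Measure.pi fun _ : Fin m => P) (B n) := measure_iUnion_le _
      _ ≤ ∑' n, ENNReal.ofReal (r n * δ) := ENNReal.tsum_le_tsum hB
      _ = ENNReal.ofReal δ := by
          have hgeom : HasSum (fun n => r n * δ) δ := by
            convert hasSum_geometric_two' δ using 2 with n
            simp only [r, one_div, inv_pow, pow_succ]
            field_simp
          rw [← ENNReal.ofReal_tsum_of_nonneg (fun n => (mul_pos (hr0 n) hδ0).le) hgeom.summable,
            hgeom.tsum_eq]
  refine ⟨(toMeasurable μ C)ᶜ, (measurableSet_toMeasurable μ C).compl, ?_, ?_⟩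
  · rw [prob_compl_eq_one_sub (measurableSet_toMeasurable μ C), measure_toMeasurable,
      ENNReal.ofReal_sub _ hδ0.le, ENNReal.ofReal_one]
    exact tsub_le_tsub_left hC _
  intro ω hω γ hγ0 hγ1 g hg N hN
  obtain ⟨n, hn1, hn2⟩ := exists_nat_pow_near_of_lt_one hγ0 hγ1
    (by norm_num : (0 : ℝ) < 1 / 2) (by norm_num)
  have hn3 : γ ≤ 2 * r n := by
    have : 2 * r n = (1 / 2) ^ n := by simp only [r, pow_succ]; ring
    rwa [this]
  have hle : uniformCoveringNumber (r n / 2) (squashedClass op (r n) G) (2 * m) ≤ N :=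
    (uniformCoveringNumber_squashedClass_le op G (2 * m) (hr0 n).le hn1.le (by linarith)).trans
      hN.le
  obtain ⟨N', hN'⟩ := ENat.ne_top_iff_exists.1 (ne_top_of_le_ne_top (ENat.natCast_ne_top N) hle)
  have hN'N : N' ≤ N := by
    rw [← hN'] at hle
    exact_mod_cast hle
  have hω' : (fun i => s i ω) ∉ B n := fun hmem =>
    hω (subset_toMeasurable μ C (Set.mem_iUnion.2 ⟨n, hmem⟩))
  have hgood := not_le.1 fun hle' => hω' ⟨N', hN'.symm, g, hg, hle'⟩
  -- A nonempty class over a nonempty space has a positive covering number.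
  have hN'pos : 0 < N' := by
    by_contra h0
    obtain ⟨F, hF, hF'⟩ := exists_finset_thresholdClose hQ2 op (hr0 n) G hN'.ge
      (fun i => s i ω, fun i => s i ω)
    obtain ⟨f, hf, -⟩ := hF' _ ⟨g, hg, rfl⟩
    have := Finset.card_pos.2 ⟨f, hf⟩
    omega
  have hemp : (1 / (m : ℝ)) * (∑ i, if labeledMargin g (s i ω) ≤ r n then (1 : ℝ) else 0) ≤
      empiricalMarginRisk op γ (fun i => s i ω) g := by
    refine mul_le_mul_of_nonneg_left (Finset.sum_le_sum fun i _ => ?_) (by positivity)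
    by_cases h1 : labeledMargin g (s i ω) ≤ r n
    · have h2 : op.apply (g (s i ω).1) (s i ω).2 < γ := by
        rcases le_or_gt (labeledMargin g (s i ω)) 0 with h3 | h3
        · exact (op.apply_nonpos hQ2 h3).trans_lt hγ0
        · rw [op.apply_of_pos h3]
          exact lt_of_le_of_lt h1 hn1
      rw [if_pos h1, if_pos h2]
    · rw [if_neg h1]
      split_ifs <;> norm_num
  have hN'0 : (0 : ℝ) < N' := by exact_mod_cast hN'pos
  have hsqrt : Real.sqrt ((2 / (m : ℝ)) * (Real.log (2 * N') + Real.log (1 / (r n * δ)))) ≤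
      Real.sqrt ((2 / (m : ℝ)) * (Real.log (2 * N) + Real.log (2 / (γ * δ)))) := by
    refine Real.sqrt_le_sqrt (mul_le_mul_of_nonneg_left (add_le_add ?_ ?_) (by positivity))
    · refine Real.log_le_log (by positivity) ?_
      have : (N' : ℝ) ≤ N := by exact_mod_cast hN'N
      linarith
    · refine Real.log_le_log (by have := hr0 n; positivity) ?_
      rw [div_le_div_iff₀ (mul_pos (hr0 n) hδ0) (mul_pos hγ0 hδ0)]
      nlinarith
  have : 0 < 1 / (m : ℝ) := by positivity
  linarith
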